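/- Let $\sigma>0$ and $c>0$, and let $h(x)=\Gamma(\tfrac12)\,(c^2+x^2)^{-1/2}$, $x\in\mathbb R$, be the one-dimensional inverse multiquadric (the case $n=1$, $\beta=-1$ of $h(x)=\Gamma(-\tfrac\beta2)(c^2+|x|^2)^{\beta/2}$; its order of conditional positive definiteness is $m=\max\{\lceil\beta/2\rceil,0\}=0$). Its native space $\mathcal C_{h,0}(\mathbb R)$ consists of the continuous functions $f:\mathbb R\to\mathbb C$ for which there is a constant $C\ge 0$ with $$\Big|\int f(x)\varphi(x)\,dx\Big|\le C\Big(\iint h(x-y)\varphi(x)\overline{\varphi(y)}\,dx\,dy\Big)^{1/2}\qquad\text{for all }\varphi\in C_c^\infty(\mathbb R;\mathbb C),$$ and $\|f\|_h$ is the smallest such $C$. With $\hat f(\xi)=\int f(x)e^{-ix\xi}\,dx$ (extended to $L^2$ as usual) let $$E_\sigma=\Big\{f\in L^2(\mathbb R):\ \int|\hat f(\xi)|^2e^{|\xi|^2/\sigma}\,d\xi<\infty\Big\},\qquad \|f\|_{E_\sigma}=\Big(\int|\hat f(\xi)|^2e^{|\xi|^2/\sigma}\,d\xi\Big)^{1/2}.$$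 **Theorem 2.5.** Every $f\in E_\sigma$ belongs (after modification on a null set) to $\mathcal C_{h,0}(\mathbb R)$, and $$\|f\|_h\le 2^{-5/4}\pi^{-1}\Big\{\frac1{\ln 2}+2\sqrt3\,M(c)\Big\}^{1/2}\|f\|_{E_\sigma},$$ where, with $g(\xi)=\sqrt{c\xi}\,e^{c\xi-\xi^2/\sigma}$ and $\xi^*=\frac{c\sigma+\sqrt{c^2\sigma^2+4\sigma}}4$, $$M(c)=\begin{cases}e^{1-\frac1{\sigma c^2}}&\text{if }c\le\frac2{\sqrt{3\sigma}},\\ g(\xi^*)&\text{if }c>\frac2{\sqrt{3\sigma}}.\end{cases}$$ -/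

import Mathlib

open MeasureTheory

noncomputable section

/-- The (inverse) multiquadric `h(x) = Γ(-β/2) (c² + |x|²)^(β/2)` on the real line. -/
def multiquadric (β c : ℝ) (x : ℝ) : ℝ :=
  Real.Gamma (-β / 2) * (c ^ 2 + |x| ^ 2) ^ (β / 2)

/-- The order of conditional positive definiteness `m = max (⌈β/2⌉, 0)` of the multiquadric. -/
def cpdOrder (β : ℝ) : ℕ := (max ⌈β / 2⌉ 0).toNat

/-- The space `𝒟_m` of complex test functions (smooth, compactly supported) on the real line whose
moments of order `< m` vanish. For `m = 0` these are all test functions. -/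
def testFunctions (m : ℕ) : Set (ℝ → ℂ) :=
  {φ | ContDiff ℝ (⊤ : ℕ∞) φ ∧ HasCompactSupport φ ∧ ∀ k < m, ∫ x : ℝ, (x : ℂ) ^ k * φ x = 0}

/-- The quadratic form `∬ h(x - y) φ(x) conj(φ(y)) dx dy` (a real number, as `h` is even). -/
def kernelForm (h : ℝ → ℝ) (φ : ℝ → ℂ) : ℝ :=
  (∫ x : ℝ, ∫ y : ℝ, (h (x - y) : ℂ) * φ x * (starRingEnd ℂ) (φ y)).re

/-- `C` is admissible for `f` if `|∫ f φ| ≤ C (∬ h(x - y) φ(x) conj(φ(y)) dx dy)^(1/2)`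
for all `φ ∈ 𝒟_m`. -/
def IsNativeBound (h : ℝ → ℝ) (m : ℕ) (f : ℝ → ℂ) (C : ℝ) : Prop :=
  0 ≤ C ∧ ∀ φ ∈ testFunctions m, ‖∫ x : ℝ, f x * φ x‖ ≤ C * Real.sqrt (kernelForm h φ)

/-- The native space `𝒞_{h,m}(ℝ)` of Madych and Nelson: the continuous functions that have an
admissible constant. -/
def nativeSpace (h : ℝ → ℝ) (m : ℕ) : Set (ℝ → ℂ) :=
  {f | Continuous f ∧ ∃ C : ℝ, IsNativeBound h m f C}

/-- The `h`-norm `‖f‖_h`: the smallest admissible constant. -/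
def nativeNorm (h : ℝ → ℝ) (m : ℕ) (f : ℝ → ℂ) : ℝ :=
  sInf {C : ℝ | IsNativeBound h m f C}

/-- The Fourier transform of `f ∈ L²(ℝ)` in the normalization `f̂(ξ) = ∫ f(x) e^(-i x ξ) dx`.
Mathlib's `𝓕` has `e^(-2π i x ξ)` in place of `e^(-i x ξ)`, hence the rescaling. -/
def angularFourier (f : Lp ℂ 2 (volume : Measure ℝ)) (ξ : ℝ) : ℂ :=
  (FourierTransform.fourier f : Lp ℂ 2 (volume : Measure ℝ)) (ξ / (2 * Real.pi))

/-- The space `E_σ` of all `f ∈ L²(ℝ)` with `∫ |f̂(ξ)|² e^(|ξ|²/σ) dξ < ∞`. -/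
def gaussianSpace (σ : ℝ) : Set (Lp ℂ 2 (volume : Measure ℝ)) :=
  {f | Integrable (fun ξ : ℝ => ‖angularFourier f ξ‖ ^ 2 * Real.exp (|ξ| ^ 2 / σ))}

/-- The norm `‖f‖_{E_σ} = (∫ |f̂(ξ)|² e^(|ξ|²/σ) dξ)^(1/2)`. -/
def gaussianNorm (σ : ℝ) (f : Lp ℂ 2 (volume : Measure ℝ)) : ℝ :=
  Real.sqrt (∫ ξ : ℝ, ‖angularFourier f ξ‖ ^ 2 * Real.exp (|ξ| ^ 2 / σ))

/-- The function `g(ξ) = √(cξ) e^(cξ - ξ²/σ)`. -/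
def gFun (σ c ξ : ℝ) : ℝ :=
  Real.sqrt (c * ξ) * Real.exp (c * ξ - ξ ^ 2 / σ)

/-- The constant `M(c)`. -/
def MConst (σ c : ℝ) : ℝ :=
  if c ≤ 2 / Real.sqrt (3 * σ) then Real.exp (1 - 1 / (σ * c ^ 2))
  else gFun σ c ((c * σ + Real.sqrt (c ^ 2 * σ ^ 2 + 4 * σ)) / 4)

end

/-! The kernel `h` is the Fourier integral of a positive integrable density `H`, a multiple of the
Bessel function K₀(2πc|η|). Fubini turns the quadratic form of `φ` into ∫ H |𝓕⁻φ|², and the pairing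
of `f` with `φ` is ∫ 𝓕f · 𝓕⁻φ. By Cauchy-Schwarz with weight w = exp((2πη)²/σ)
(`integral_norm_mul_norm_le`), the native bound follows once w⁻¹ ≤ K² H almost everywhere.

Put t = 2πc|η|. The lower bound H ≥ 2√π e^(-t) √(π/(2t + 1/2)) (`le_multiquadricDensity`) reduces
that comparison to √(1+4t) e^(t - t²/(σc²)) ≤ 1/ln 2 + 2√3 M(c) (`sqrt_mul_exp_le`). For t ≥ 1 the
term with M(c) suffices, because M(c) dominates √t e^(t - t²/(σc²)) there. For t ≤ 1 both terms are
used. The continuous representative of `f` is the inverse Fourier integral of its transform, which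
is integrable because of the Gaussian weight. -/

/-! ### The scalar inequality behind the constant -/

lemma sqrt_one_add_four_mul_le (t : ℝ) :
    √(1 + 4 * t) ≤ √2 * Real.exp (t - 1 / 4) := by
  rw [Real.sqrt_le_left (by positivity), mul_pow, Real.sq_sqrt (by norm_num), ← Real.exp_nat_mul]
  have := Real.add_one_le_exp (((2 : ℕ) : ℝ) * (t - 1 / 4))
  push_cast at this ⊢
  linarith

lemma exp_one_third_le : Real.exp (1 / 3) ≤ 1.3957 := by
  refine le_of_pow_le_pow_left₀ (n := 3) (by norm_num) (by norm_num) ?_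
  rw [← Real.exp_nat_mul]
  norm_num
  linarith [Real.exp_one_lt_d9]

lemma exp_half_le : Real.exp (1 / 2) ≤ 1.6488 := by
  refine le_of_pow_le_pow_left₀ (n := 2) (by norm_num) (by norm_num) ?_
  rw [← Real.exp_nat_mul]
  norm_num
  linarith [Real.exp_one_lt_d9]

lemma exp_two_thirds_le : Real.exp (2 / 3) ≤ 1.9481 := by
  have h : Real.exp (2 / 3) = Real.exp (1 / 3) * Real.exp (1 / 3) := by
    rw [← Real.exp_add]; norm_num
  rw [h]
  nlinarith [exp_one_third_le, Real.exp_pos (1 / 3)]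

lemma le_exp_quarter : 1.284 ≤ Real.exp (1 / 4) := by
  refine le_of_pow_le_pow_left₀ (n := 4) (by norm_num) (by positivity) ?_
  rw [← Real.exp_nat_mul]
  norm_num
  linarith [Real.exp_one_gt_d9]

lemma sqrt_two_mul_exp_neg_quarter_le : √2 * Real.exp (-(1 / 4)) ≤ 1.1016 := by
  have h2 : √2 ≤ 1.41422 := by
    rw [Real.sqrt_le_left (by norm_num)]; norm_num
  rw [Real.exp_neg, ← div_eq_mul_inv, div_le_iff₀ (Real.exp_pos _)]
  linarith [le_exp_quarter]

lemma le_one_div_log_two : 1.4425 ≤ 1 / Real.log 2 := by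
  rw [le_div_iff₀ (Real.log_pos (by norm_num))]
  linarith [Real.log_two_lt_d9]

/-- The bound on `t ≤ 1`. -/
lemma sqrt_mul_exp_le_of_le_one {a t : ℝ} (ha : 0 < a) (ht : t ≤ 1) :
    √(1 + 4 * t) * Real.exp (t - a * t ^ 2) ≤
      1 / Real.log 2 + 2 * √3 * Real.exp (1 - a) := by
  have h3 : 1.73 ≤ √3 := Real.le_sqrt_of_sq_le (by norm_num)
  have hP := sqrt_two_mul_exp_neg_quarter_le
  have hP0 : 0 < √2 * Real.exp (-(1 / 4)) := by positivity
  have hl := le_one_div_log_two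
  -- The square root is traded for an exponential, with equality at t = 1/4, so that only a
  -- quadratic exponent with maximum 1/a remains.
  have h1 : √(1 + 4 * t) * Real.exp (t - a * t ^ 2) ≤
      √2 * Real.exp (-(1 / 4)) * Real.exp (2 * t - a * t ^ 2) := by
    refine (mul_le_mul_of_nonneg_right (sqrt_one_add_four_mul_le t)
      (Real.exp_pos _).le).trans_eq ?_
    rw [mul_assoc, mul_assoc, ← Real.exp_add, ← Real.exp_add]
    ring_nf
  have h2 : 2 * t - a * t ^ 2 ≤ 1 / a := by
    rw [le_div_iff₀ ha]; nlinarith [sq_nonneg (a * t - 1)]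
  have hR : 1.4425 + 3.46 * Real.exp (1 - a) ≤
      1 / Real.log 2 + 2 * √3 * Real.exp (1 - a) := by
    nlinarith [Real.exp_pos (1 - a)]
  -- Numerical form of the goal: 1.1016 bounds √2 e^(-1/4) from above, while 1.4425 and 3.46 bound
  -- 1/ln 2 and 2√3 from below. On each range of a, the exponent is bounded at the left end and
  -- e^(1-a) at the right end.
  have key : ∀ {u v : ℝ}, 2 * t - a * t ^ 2 ≤ u → Real.exp u ≤ v →
      1.1016 * v ≤ 1.4425 + 3.46 * Real.exp (1 - a) →
      √(1 + 4 * t) * Real.exp (t - a * t ^ 2) ≤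
        1 / Real.log 2 + 2 * √3 * Real.exp (1 - a) := by
    intro u v hu hv h
    refine h1.trans (le_trans ?_ (h.trans hR))
    exact mul_le_mul hP ((Real.exp_le_exp.2 hu).trans hv) (Real.exp_pos _).le (by norm_num)
  have low : ∀ {x b : ℝ}, a ≤ x + 1 → b * Real.exp x ≤ 1 → b ≤ Real.exp (1 - a) := by
    intro x b hx hb
    have : b ≤ Real.exp (-x) := by
      rw [Real.exp_neg, ← one_div, le_div_iff₀ (Real.exp_pos _)]; exact hb
    exact this.trans (Real.exp_le_exp.2 (by linarith))
  have inv : ∀ {b u : ℝ}, 0 < b → b ≤ a → 1 / b = u → 2 * t - a * t ^ 2 ≤ u := by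
    rintro b u hb hba rfl
    exact h2.trans (one_div_le_one_div_of_le hb hba)
  have he := Real.exp_one_lt_d9
  rcases le_total 4 a with h4 | h4
  -- For a ≥ 4 the left side is at most √2, which lies just below 1/ln 2.
  · refine h1.trans (le_trans ?_ (hl.trans (le_add_of_nonneg_right (by positivity))))
    have : Real.exp (2 * t - a * t ^ 2) ≤ Real.exp (1 / 4) :=
      Real.exp_le_exp.2 (inv (by norm_num) h4 (by norm_num))
    calc _ ≤ √2 * Real.exp (-(1 / 4)) * Real.exp (1 / 4) := by gcongr
      _ = √2 := by rw [mul_assoc, ← Real.exp_add]; simp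
      _ ≤ _ := by rw [Real.sqrt_le_left (by norm_num)]; norm_num
  rcases le_total 3 a with h3a | h3a
  · refine key (inv (by norm_num) h3a rfl) exp_one_third_le ?_
    have : (0.049 : ℝ) ≤ Real.exp (1 - a) := by
      refine low (x := 3) (by linarith) ?_
      have : Real.exp 3 = Real.exp 1 ^ 3 := by rw [← Real.exp_nat_mul]; norm_num
      rw [this]
      have := pow_le_pow_left₀ (Real.exp_pos 1).le he.le 3
      norm_num at this ⊢
      linarith
    linarith
  rcases le_total 2 a with h2a | h2a
  · refine key (inv (by norm_num) h2a rfl) exp_half_le ?_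
    have : (0.135 : ℝ) ≤ Real.exp (1 - a) := by
      refine low (x := 2) (by linarith) ?_
      have : Real.exp 2 = Real.exp 1 ^ 2 := by rw [← Real.exp_nat_mul]; norm_num
      rw [this]
      have := pow_le_pow_left₀ (Real.exp_pos 1).le he.le 2
      norm_num at this ⊢
      linarith
    linarith
  rcases le_total (3 / 2) a with h32 | h32
  · refine key (inv (by norm_num) h32 (by norm_num)) exp_two_thirds_le ?_
    have : (0.36 : ℝ) ≤ Real.exp (1 - a) := low (x := 1) (by linarith) (by linarith)
    linarith
  rcases le_total 1 a with h1a | h1a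
  · refine key (inv (by norm_num) h1a (by norm_num)) he.le ?_
    have : (0.6 : ℝ) ≤ Real.exp (1 - a) :=
      low (x := 1 / 2) (by linarith) (by linarith [exp_half_le])
    linarith
  -- For a ≤ 1 the vertex 1/a is at least 1, so on t ≤ 1 the exponent is largest at t = 1. The
  -- common factor e^(1-a) then absorbs the dependence on a.
  · have h2 : 2 * t - a * t ^ 2 ≤ 1 + (1 - a) := by
      nlinarith [mul_nonneg (sub_nonneg.2 ht) (sub_nonneg.2 h1a),
        mul_nonneg ha.le (sq_nonneg (1 - t))]
    refine key h2 (Real.exp_add _ _).le ?_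
    nlinarith [Real.exp_pos (1 - a)]

/-- The logarithmic derivative 1/(2t) + 1 - 2at is nonpositive on all of [1, ∞) exactly when a ≥
3/4, so the maximum sits at t = 1. -/
lemma sqrt_mul_exp_le_exp {a t : ℝ} (ha : 3 / 4 ≤ a) (ht : 1 ≤ t) :
    √t * Real.exp (t - a * t ^ 2) ≤ Real.exp (1 - a) := by
  have h : √t ≤ Real.exp ((t - 1) / 2) := by
    rw [Real.sqrt_le_left (by positivity), ← Real.exp_nat_mul]
    have := Real.add_one_le_exp (((2 : ℕ) : ℝ) * ((t - 1) / 2))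
    push_cast at this ⊢
    linarith
  calc _ ≤ Real.exp ((t - 1) / 2) * Real.exp (t - a * t ^ 2) := by gcongr
    _ = Real.exp ((t - 1) / 2 + (t - a * t ^ 2)) := (Real.exp_add _ _).symm
    _ ≤ _ := by
      have h1 := sub_nonneg.2 ht
      have h2 := sub_nonneg.2 ha
      refine Real.exp_le_exp.2 ?_
      nlinarith [mul_nonneg h1 h2, mul_nonneg (mul_nonneg h1 h1) h2]

/-- A positive critical point of `t ↦ √t * exp (t - a * t ^ 2)` is a maximum point. -/
lemma sqrt_mul_exp_le_of_critical {a t τ : ℝ} (ha : 0 < a) (hτ : 0 < τ)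
    (h : 2 * a * τ ^ 2 = τ + 1 / 2) :
    √t * Real.exp (t - a * t ^ 2) ≤ √τ * Real.exp (τ - a * τ ^ 2) := by
  -- Tangent bound for the logarithm at τ. By the critical equation, the resulting exponent is τ -
  -- aτ² - a(t - τ)².
  have h1 : √t ≤ √τ * Real.exp ((t - τ) / (2 * τ)) := by
    rw [Real.sqrt_le_left (by positivity), mul_pow, Real.sq_sqrt hτ.le, ← Real.exp_nat_mul]
    have := mul_le_mul_of_nonneg_left
      (Real.add_one_le_exp (((2 : ℕ) : ℝ) * ((t - τ) / (2 * τ)))) hτ.le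
    refine le_trans (le_of_eq ?_) this
    push_cast
    field_simp
    ring
  have h2 : (t - τ) / (2 * τ) + (t - a * t ^ 2) ≤ τ - a * τ ^ 2 := by
    have : (t - τ) / (2 * τ) = (t - τ) * (2 * a * τ - 1) := by
      field_simp
      linear_combination (-(t - τ)) * 2 * h
    rw [this]
    nlinarith [mul_nonneg ha.le (sq_nonneg (t - τ))]
  calc _ ≤ √τ * Real.exp ((t - τ) / (2 * τ)) * Real.exp (t - a * t ^ 2) := by gcongr
    _ = √τ * Real.exp ((t - τ) / (2 * τ) + (t - a * t ^ 2)) := by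
      rw [Real.exp_add, mul_assoc]
    _ ≤ _ := by gcongr

/-- With t = cξ and a = 1/(σc²) the left side is g(ξ). The threshold c ≤ 2/√(3σ) is a ≥ 3/4, and
otherwise cξ* is the positive critical point. -/
lemma sqrt_mul_exp_le_MConst {σ c t : ℝ} (hσ : 0 < σ) (hc : 0 < c) (ht : 1 ≤ t) :
    √t * Real.exp (t - 1 / (σ * c ^ 2) * t ^ 2) ≤ MConst σ c := by
  have hiff : c ≤ 2 / √(3 * σ) ↔ 3 / 4 ≤ 1 / (σ * c ^ 2) := by
    rw [le_div_iff₀ (by positivity), le_div_iff₀ (by positivity),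
      ← pow_le_pow_iff_left₀ (by positivity) (by positivity) two_ne_zero, mul_pow,
      Real.sq_sqrt (by positivity)]
    constructor <;> intro h <;> nlinarith
  unfold MConst
  split_ifs with h
  · exact sqrt_mul_exp_le_exp (hiff.1 h) ht
  · set r := √(c ^ 2 * σ ^ 2 + 4 * σ) with hr
    have hr2 : r ^ 2 = c ^ 2 * σ ^ 2 + 4 * σ := Real.sq_sqrt (by positivity)
    have hr0 : 0 ≤ r := Real.sqrt_nonneg _
    set τ := c * ((c * σ + r) / 4) with hτ
    have hτ0 : 0 < τ := by positivity
    refine (sqrt_mul_exp_le_of_critical (τ := τ) (by positivity) hτ0 ?_).trans_eq ?_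
    · rw [hτ]
      field_simp
      nlinarith
    · unfold gFun
      rw [← hτ]
      congr 3
      rw [hτ]
      field_simp

lemma sqrt_mul_exp_le {σ c t : ℝ} (hσ : 0 < σ) (hc : 0 < c) :
    √(1 + 4 * t) * Real.exp (t - t ^ 2 / (σ * c ^ 2)) ≤
      1 / Real.log 2 + 2 * √3 * MConst σ c := by
  have ht2 : t ^ 2 / (σ * c ^ 2) = 1 / (σ * c ^ 2) * t ^ 2 := by ring
  rw [ht2]
  rcases le_total t 1 with ht | ht
  · refine (sqrt_mul_exp_le_of_le_one (by positivity) ht).trans ?_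
    -- At t = 1 this reads e^(1-a) ≤ M(c), in both branches of the definition.
    have := sqrt_mul_exp_le_MConst hσ hc le_rfl
    simp only [Real.sqrt_one, one_pow, mul_one, one_mul] at this
    gcongr
  -- For t ≥ 1 one has 1 + 4t ≤ 12t.
  · have h1 : √(1 + 4 * t) ≤ 2 * √3 * √t := by
      rw [Real.sqrt_le_left (by positivity), mul_pow, mul_pow, Real.sq_sqrt (by norm_num),
        Real.sq_sqrt (by linarith)]
      linarith
    have h2 := sqrt_mul_exp_le_MConst hσ hc ht
    calc _ ≤ 2 * √3 * √t * Real.exp (t - 1 / (σ * c ^ 2) * t ^ 2) := by gcongr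
      _ = 2 * √3 * (√t * Real.exp (t - 1 / (σ * c ^ 2) * t ^ 2)) := by ring
      _ ≤ 2 * √3 * MConst σ c := by gcongr
      _ ≤ _ := le_add_of_nonneg_left (by linarith [le_one_div_log_two])

/-! ### The kernel as a Fourier integral -/

/-- The integrand in `2 √π K₀(2πc|η|) = ∫_{s > 0} √π s⁻¹ exp (-(c² s + π² η² / s)) ds`. -/
noncomputable def besselIntegrand (c s η : ℝ) : ℝ :=
  √Real.pi * s⁻¹ * Real.exp (-(c ^ 2 * s + Real.pi ^ 2 * η ^ 2 / s))

/-- The Fourier transform of the inverse multiquadric. -/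
noncomputable def multiquadricDensity (c η : ℝ) : ℝ :=
  ∫ s in Set.Ioi (0 : ℝ), besselIntegrand c s η

lemma besselIntegrand_nonneg {c s η : ℝ} (hs : 0 < s) : 0 ≤ besselIntegrand c s η := by
  unfold besselIntegrand; positivity

lemma multiquadricDensity_nonneg (c η : ℝ) : 0 ≤ multiquadricDensity c η :=
  setIntegral_nonneg measurableSet_Ioi fun _ hs => besselIntegrand_nonneg hs

lemma measurable_besselIntegrand (c : ℝ) :
    Measurable (Function.uncurry (besselIntegrand c)) := by
  unfold besselIntegrand Function.uncurry
  fun_prop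

lemma besselIntegrand_eq (c s η : ℝ) : besselIntegrand c s η =
    √Real.pi * s⁻¹ * Real.exp (-(c ^ 2 * s)) * Real.exp (-(Real.pi ^ 2 / s) * η ^ 2) := by
  unfold besselIntegrand
  rw [mul_assoc _ (Real.exp _), ← Real.exp_add]
  ring_nf

lemma integrable_besselIntegrand_right (c : ℝ) {s : ℝ} (hs : 0 < s) :
    Integrable (besselIntegrand c s) := by
  have : besselIntegrand c s = fun η => √Real.pi * s⁻¹ * Real.exp (-(c ^ 2 * s)) *
      Real.exp (-(Real.pi ^ 2 / s) * η ^ 2) := funext (besselIntegrand_eq c s)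
  rw [this]
  exact (integrable_exp_neg_mul_sq (by positivity)).const_mul _

lemma sqrt_mul_inv_mul_sqrt {s : ℝ} (hs : 0 < s) :
    √Real.pi * s⁻¹ * √(Real.pi / (Real.pi ^ 2 / s)) = s ^ ((1 / 2 : ℝ) - 1) := by
  have h1 : Real.pi / (Real.pi ^ 2 / s) = s / Real.pi := by
    field_simp
  have h2 : s ^ ((1 / 2 : ℝ) - 1) = √s * s⁻¹ := by
    rw [Real.rpow_sub hs, Real.rpow_one, Real.sqrt_eq_rpow, div_eq_mul_inv]
  have := Real.sqrt_ne_zero'.2 Real.pi_pos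
  rw [h1, h2, Real.sqrt_div hs.le]
  field_simp

lemma integral_besselIntegrand_right (c : ℝ) {s : ℝ} (hs : 0 < s) :
    ∫ η, besselIntegrand c s η = s ^ ((1 / 2 : ℝ) - 1) * Real.exp (-(c ^ 2 * s)) := by
  simp_rw [besselIntegrand_eq]
  rw [integral_const_mul, integral_gaussian, ← sqrt_mul_inv_mul_sqrt hs]
  ring

/-- Integrating the Gaussian in η first leaves s^(-1/2) e^(-c²s), a convergent Gamma integrand;
Tonelli does the rest. -/
lemma integrable_uncurry_besselIntegrand {c : ℝ} (hc : 0 < c) :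
    Integrable (Function.uncurry (besselIntegrand c))
      ((volume.restrict (Set.Ioi (0 : ℝ))).prod volume) := by
  rw [integrable_prod_iff (measurable_besselIntegrand c).aestronglyMeasurable]
  constructor
  · filter_upwards [ae_restrict_mem measurableSet_Ioi] with s hs
    exact integrable_besselIntegrand_right c hs
  · have h := integrableOn_rpow_mul_exp_neg_mul_rpow (p := 1) (s := (1 / 2 : ℝ) - 1)
      (b := c ^ 2) (by norm_num) one_pos (by positivity)
    refine h.congr_fun (fun s hs => ?_) measurableSet_Ioi
    have hs : 0 < s := hs
    simp only [Function.uncurry_apply_pair, Real.norm_of_nonneg (besselIntegrand_nonneg hs),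
      integral_besselIntegrand_right c hs, Real.rpow_one, neg_mul]

lemma integrable_multiquadricDensity {c : ℝ} (hc : 0 < c) :
    Integrable (multiquadricDensity c) :=
  (integrable_uncurry_besselIntegrand hc).integral_prod_right

/-- The Gaussian in η transforms to a multiple of e^(-x²s), which leaves the Gamma integrand whose
integral over s is Γ(1/2)(c² + x²)^(-1/2). -/
lemma integral_besselIntegrand_mul_cexp (c x : ℝ) {s : ℝ} (hs : 0 < s) :
    ∫ η : ℝ, (besselIntegrand c s η : ℂ) * Complex.exp (2 * Real.pi * η * x * Complex.I) =
      ((s ^ ((1 / 2 : ℝ) - 1) * Real.exp (-((c ^ 2 + x ^ 2) * s)) : ℝ) : ℂ) := by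
  have hb : 0 < (((Real.pi ^ 2 / s : ℝ)) : ℂ).re := by
    rw [Complex.ofReal_re]; positivity
  have h := fourierIntegral_gaussian hb (2 * Real.pi * x)
  have e : (Real.pi / ((Real.pi ^ 2 / s : ℝ) : ℂ)) ^ (1 / 2 : ℂ) =
      ((√(Real.pi / (Real.pi ^ 2 / s)) : ℝ) : ℂ) := by
    rw [Real.sqrt_eq_rpow, Complex.ofReal_cpow (by positivity)]
    push_cast
    rfl
  have e2 : Complex.exp (-(2 * Real.pi * x : ℂ) ^ 2 / (4 * ((Real.pi ^ 2 / s : ℝ) : ℂ))) =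
      ((Real.exp (-(x ^ 2 * s)) : ℝ) : ℂ) := by
    have : (Real.pi : ℂ) ≠ 0 := by exact_mod_cast Real.pi_ne_zero
    have : (s : ℂ) ≠ 0 := by exact_mod_cast hs.ne'
    push_cast
    congr 1
    field_simp
    ring
  rw [e, e2] at h
  have : ∀ η : ℝ, (besselIntegrand c s η : ℂ) *
      Complex.exp (2 * Real.pi * η * x * Complex.I) =
      ((√Real.pi * s⁻¹ * Real.exp (-(c ^ 2 * s)) : ℝ) : ℂ) *
      (Complex.exp (Complex.I * (2 * Real.pi * x) * η) *
        Complex.exp (-((Real.pi ^ 2 / s : ℝ) : ℂ) * η ^ 2)) := by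
    intro η
    rw [besselIntegrand_eq]
    push_cast
    ring_nf
  simp_rw [this]
  rw [integral_const_mul, h, ← sqrt_mul_inv_mul_sqrt hs, add_mul, neg_add, Real.exp_add]
  push_cast
  ring

lemma norm_cexp_mul_I (x η : ℝ) : ‖Complex.exp (2 * Real.pi * η * x * Complex.I)‖ = 1 := by
  have := Complex.norm_exp_ofReal_mul_I (2 * Real.pi * η * x)
  push_cast at this
  exact this

/-- The inverse multiquadric is the Fourier integral of its density. -/
lemma integral_multiquadricDensity_mul_cexp {c : ℝ} (hc : 0 < c) (x : ℝ) :
    ∫ η : ℝ, (multiquadricDensity c η : ℂ) * Complex.exp (2 * Real.pi * η * x * Complex.I) =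
      (multiquadric (-1) c x : ℂ) := by
  have hint : Integrable (Function.uncurry fun s η : ℝ => (besselIntegrand c s η : ℂ) *
      Complex.exp (2 * Real.pi * η * x * Complex.I))
      ((volume.restrict (Set.Ioi (0 : ℝ))).prod volume) := by
    refine (integrable_uncurry_besselIntegrand hc).ofReal.mul_bdd (c := 1)
      (g := fun p : ℝ × ℝ => Complex.exp (2 * Real.pi * p.2 * x * Complex.I)) ?_ ?_
    · exact Continuous.aestronglyMeasurable (by fun_prop)
    · exact Filter.Eventually.of_forall fun p => (norm_cexp_mul_I x p.2).le
  have hswap := integral_integral_swap hint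
  have h1 : ∀ η : ℝ, (multiquadricDensity c η : ℂ) *
      Complex.exp (2 * Real.pi * η * x * Complex.I) =
      ∫ s in Set.Ioi (0 : ℝ), (besselIntegrand c s η : ℂ) *
        Complex.exp (2 * Real.pi * η * x * Complex.I) := by
    intro η
    rw [integral_mul_const, integral_complex_ofReal]
    rfl
  simp_rw [h1]
  rw [← hswap, setIntegral_congr_fun measurableSet_Ioi
    fun s hs => integral_besselIntegrand_mul_cexp c x hs, integral_complex_ofReal,
    Real.integral_rpow_mul_exp_neg_mul_Ioi (by norm_num) (by positivity)]
  unfold multiquadric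
  rw [sq_abs, one_div, Real.inv_rpow (by positivity), ← Real.rpow_neg (by positivity)]
  norm_num [mul_comm]

/-! ### Lower bound for the density -/

section LowerBound

/-- The substitution `κ * exp (2 * arsinh v)` of the line onto the positive half line. -/
lemma hasDerivAt_mul_exp_two_mul_arsinh (κ v : ℝ) :
    HasDerivAt (fun v => κ * Real.exp (2 * Real.arsinh v))
      (κ * Real.exp (2 * Real.arsinh v) * (2 * (√(1 + v ^ 2))⁻¹)) v := by
  have := (((Real.hasDerivAt_arsinh v).const_mul 2).exp).const_mul κ
  rwa [← mul_assoc] at this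

lemma injective_mul_exp_two_mul_arsinh {κ : ℝ} (hκ : 0 < κ) :
    Function.Injective (fun v => κ * Real.exp (2 * Real.arsinh v)) := by
  intro v w h
  have := Real.exp_injective (mul_left_cancel₀ hκ.ne' h)
  exact Real.arsinh_injective (by linarith)

lemma range_mul_exp_two_mul_arsinh {κ : ℝ} (hκ : 0 < κ) :
    (fun v => κ * Real.exp (2 * Real.arsinh v)) '' Set.univ = Set.Ioi 0 := by
  ext s
  simp only [Set.image_univ, Set.mem_range, Set.mem_Ioi]
  constructor
  · rintro ⟨v, rfl⟩; positivity
  · intro hs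
    refine ⟨Real.sinh (Real.log (s / κ) / 2), ?_⟩
    rw [Real.arsinh_sinh, mul_div_cancel₀ _ two_ne_zero, Real.exp_log (by positivity)]
    field_simp

/-- With s = (π|η|/c) e^u the exponent c²s + π²η²/s becomes t cosh u, t = 2πc|η|. Setting v =
sinh(u/2) gives cosh u = 1 + 2v², so e^(-t) factors out and a Gaussian in v remains. -/
lemma besselIntegrand_comp {c η : ℝ} (hc : 0 < c) (hη : η ≠ 0) (v : ℝ) :
    |Real.pi * |η| / c * Real.exp (2 * Real.arsinh v) * (2 * (√(1 + v ^ 2))⁻¹)| •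
      besselIntegrand c (Real.pi * |η| / c * Real.exp (2 * Real.arsinh v)) η =
    2 * √Real.pi * Real.exp (-(2 * Real.pi * c * |η|)) * ((√(1 + v ^ 2))⁻¹ *
      Real.exp (-(2 * (2 * Real.pi * c * |η|)) * v ^ 2)) := by
  have hη' : 0 < |η| := abs_pos.2 hη
  have hπ := Real.pi_pos
  rw [abs_of_pos (by positivity), smul_eq_mul]
  unfold besselIntegrand
  set E := Real.exp (2 * Real.arsinh v) with hE
  have hE0 : 0 < E := Real.exp_pos _
  have hcosh : E + E⁻¹ = 2 * (1 + 2 * v ^ 2) := by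
    have h1 := Real.cosh_eq (2 * Real.arsinh v)
    rw [Real.cosh_two_mul, Real.cosh_sq, Real.sinh_arsinh, Real.exp_neg, ← hE] at h1
    linarith
  have hexp : c ^ 2 * (Real.pi * |η| / c * E) + Real.pi ^ 2 * η ^ 2 / (Real.pi * |η| / c * E) =
      2 * Real.pi * c * |η| + 2 * (2 * Real.pi * c * |η|) * v ^ 2 := by
    have : c ^ 2 * (Real.pi * |η| / c * E) + Real.pi ^ 2 * η ^ 2 / (Real.pi * |η| / c * E) =
        Real.pi * c * |η| * (E + E⁻¹) := by
      rw [← sq_abs η]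
      field_simp
    rw [this, hcosh]
    ring
  rw [hexp, neg_add, Real.exp_add]
  have : 0 < √(1 + v ^ 2) := by positivity
  field_simp

lemma exp_le_inv_sqrt_one_add_sq (v : ℝ) :
    Real.exp (-(1 / 2) * v ^ 2) ≤ (√(1 + v ^ 2))⁻¹ := by
  rw [neg_mul, Real.exp_neg]
  refine inv_anti₀ (by positivity) ?_
  rw [Real.sqrt_le_left (by positivity), ← Real.exp_nat_mul]
  have := Real.add_one_le_exp (((2 : ℕ) : ℝ) * (1 / 2 * v ^ 2))
  push_cast at this ⊢
  linarith

/-- After the substitution, replacing the factor (1 + v²)^(-1/2) by the smaller e^(-v²/2) leaves a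
pure Gaussian integral, whose rate is 2t + 1/2. -/
lemma le_multiquadricDensity {c η : ℝ} (hc : 0 < c) (hη : η ≠ 0) :
    2 * √Real.pi * Real.exp (-(2 * Real.pi * c * |η|)) *
      √(Real.pi / (2 * (2 * Real.pi * c * |η|) + 1 / 2)) ≤ multiquadricDensity c η := by
  have hη' : 0 < |η| := abs_pos.2 hη
  have hπ := Real.pi_pos
  have hκ : 0 < Real.pi * |η| / c := by positivity
  unfold multiquadricDensity
  rw [← range_mul_exp_two_mul_arsinh hκ, integral_image_eq_integral_abs_deriv_smul
    MeasurableSet.univ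
    (fun v _ => (hasDerivAt_mul_exp_two_mul_arsinh (Real.pi * |η| / c) v).hasDerivWithinAt)
    (injective_mul_exp_two_mul_arsinh hκ).injOn, setIntegral_univ]
  simp_rw [besselIntegrand_comp hc hη]
  rw [integral_const_mul, ← integral_gaussian]
  set t := 2 * Real.pi * c * |η| with ht
  have ht0 : 0 < t := by positivity
  gcongr _ * ?_
  have hcont : Continuous fun v : ℝ => (√(1 + v ^ 2))⁻¹ := by
    refine Continuous.inv₀ (by fun_prop) fun v => ?_
    positivity
  refine integral_mono (integrable_exp_neg_mul_sq (by positivity)) ?_ fun v => ?_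
  · refine (integrable_exp_neg_mul_sq (b := 2 * t) (by positivity)).bdd_mul (c := 1)
      hcont.aestronglyMeasurable (Filter.Eventually.of_forall fun v => ?_)
    rw [Real.norm_of_nonneg (by positivity)]
    refine inv_le_one_of_one_le₀ (Real.one_le_sqrt.2 ?_)
    linarith [sq_nonneg v]
  · have := mul_le_mul_of_nonneg_right (exp_le_inv_sqrt_one_add_sq v)
      (Real.exp_pos (-(2 * t) * v ^ 2)).le
    refine le_of_eq_of_le ?_ this
    rw [← Real.exp_add]
    ring_nf

end LowerBound

/-! ### Fourier inversion and the quadratic form -/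

section FourierIntegrals

open FourierTransform

lemma fourierInv_apply_real (φ : ℝ → ℂ) (η : ℝ) :
    𝓕⁻ φ η = ∫ x : ℝ, Complex.exp (2 * Real.pi * η * x * Complex.I) * φ x := by
  rw [Real.fourierInv_eq']
  simp only [smul_eq_mul]
  refine integral_congr_ae (Filter.Eventually.of_forall fun x => ?_)
  simp only [RCLike.inner_apply, conj_trivial]
  push_cast
  ring_nf

lemma continuous_fourierInv {φ : ℝ → ℂ} (hφ : Integrable φ) : Continuous (𝓕⁻ φ) := by
  have : 𝓕⁻ φ = fun η : ℝ => ∫ x : ℝ, Complex.exp (2 * Real.pi * η * x * Complex.I) * φ x :=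
    funext (fourierInv_apply_real φ)
  rw [this]
  refine continuous_of_dominated (bound := fun x => ‖φ x‖) (fun η => ?_) (fun η => ?_)
    hφ.norm (Filter.Eventually.of_forall fun x => by fun_prop)
  · exact (Continuous.aestronglyMeasurable (by fun_prop)).mul hφ.aestronglyMeasurable
  · exact Filter.Eventually.of_forall fun x => by rw [norm_mul, norm_cexp_mul_I, one_mul]

lemma norm_fourierInv_le (φ : ℝ → ℂ) (η : ℝ) : ‖𝓕⁻ φ η‖ ≤ ∫ x, ‖φ x‖ := by
  rw [fourierInv_apply_real]
  refine (norm_integral_le_integral_norm _).trans_eq ?_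
  simp_rw [norm_mul, norm_cexp_mul_I, one_mul]

/-- Self-adjointness of the inverse Fourier transform. -/
lemma integral_fourierInv_mul {F φ : ℝ → ℂ} (hF : Integrable F) (hφ : Integrable φ) :
    ∫ x, 𝓕⁻ F x * φ x = ∫ η, F η * 𝓕⁻ φ η := by
  have hint : Integrable (Function.uncurry fun x η : ℝ =>
      φ x * F η * Complex.exp (2 * Real.pi * η * x * Complex.I)) (volume.prod volume) := by
    refine (hφ.mul_prod hF).mul_bdd (c := 1)
      (g := fun p : ℝ × ℝ => Complex.exp (2 * Real.pi * p.2 * p.1 * Complex.I)) ?_ ?_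
    · exact Continuous.aestronglyMeasurable (by fun_prop)
    · exact Filter.Eventually.of_forall fun p => (norm_cexp_mul_I p.1 p.2).le
  have h1 : ∀ x, 𝓕⁻ F x * φ x =
      ∫ η : ℝ, φ x * F η * Complex.exp (2 * Real.pi * η * x * Complex.I) := by
    intro x
    rw [fourierInv_apply_real, ← integral_mul_const]
    refine integral_congr_ae (Filter.Eventually.of_forall fun η => ?_)
    simp only
    rw [show (2 * Real.pi * x * η * Complex.I : ℂ) = 2 * Real.pi * η * x * Complex.I by ring]
    ring
  have h2 : ∀ η, F η * 𝓕⁻ φ η =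
      ∫ x : ℝ, φ x * F η * Complex.exp (2 * Real.pi * η * x * Complex.I) := by
    intro η
    rw [fourierInv_apply_real, ← integral_const_mul]
    refine integral_congr_ae (Filter.Eventually.of_forall fun x => ?_)
    simp only
    ring
  simp_rw [h1, h2]
  exact integral_integral_swap hint

/-- If the kernel is the Fourier integral of an integrable density, then its quadratic form is a
weighted `L²` norm of the transform. -/
lemma kernelForm_eq_integral {h H : ℝ → ℝ} {φ : ℝ → ℂ} (hH : Integrable H)
    (hh : ∀ x : ℝ, ∫ η : ℝ, (H η : ℂ) * Complex.exp (2 * Real.pi * η * x * Complex.I) = h x)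
    (hφ : Integrable φ) : kernelForm h φ = ∫ η, H η * ‖𝓕⁻ φ η‖ ^ 2 := by
  have hφc : Integrable fun y => (starRingEnd ℂ) (φ y) :=
    (Complex.conjLIE.toContinuousLinearEquiv : ℂ →L[ℝ] ℂ).integrable_comp hφ
  have hint : Integrable (Function.uncurry fun (p : ℝ × ℝ) (η : ℝ) =>
      (φ p.1 * (starRingEnd ℂ) (φ p.2)) * (H η : ℂ) *
        Complex.exp (2 * Real.pi * η * (p.1 - p.2 : ℝ) * Complex.I))
      ((volume.prod volume).prod volume) := by
    refine ((hφ.mul_prod hφc).mul_prod hH.ofReal).mul_bdd (c := 1)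
      (g := fun p : (ℝ × ℝ) × ℝ =>
        Complex.exp (2 * Real.pi * p.2 * (p.1.1 - p.1.2 : ℝ) * Complex.I)) ?_ ?_
    · exact Continuous.aestronglyMeasurable (by fun_prop)
    · exact Filter.Eventually.of_forall fun p => (norm_cexp_mul_I _ p.2).le
  have h1 : ∀ p : ℝ × ℝ, (h (p.1 - p.2) : ℂ) * φ p.1 * (starRingEnd ℂ) (φ p.2) =
      ∫ η : ℝ, (φ p.1 * (starRingEnd ℂ) (φ p.2)) * (H η : ℂ) *
        Complex.exp (2 * Real.pi * η * (p.1 - p.2 : ℝ) * Complex.I) := by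
    intro p
    simp_rw [mul_assoc (φ p.1 * (starRingEnd ℂ) (φ p.2))]
    rw [integral_const_mul, hh]
    ring
  -- Inherited from the triple integral by integrating out η.
  have hint2 : Integrable (fun p : ℝ × ℝ =>
      (h (p.1 - p.2) : ℂ) * φ p.1 * (starRingEnd ℂ) (φ p.2)) (volume.prod volume) := by
    simp_rw [h1]
    exact hint.integral_prod_left
  have h2 : ∀ η : ℝ, ∫ p : ℝ × ℝ, (φ p.1 * (starRingEnd ℂ) (φ p.2)) * (H η : ℂ) *
        Complex.exp (2 * Real.pi * η * (p.1 - p.2 : ℝ) * Complex.I) =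
      ((H η * ‖𝓕⁻ φ η‖ ^ 2 : ℝ) : ℂ) := by
    intro η
    have h3 : ∀ p : ℝ × ℝ, (φ p.1 * (starRingEnd ℂ) (φ p.2)) * (H η : ℂ) *
        Complex.exp (2 * Real.pi * η * (p.1 - p.2 : ℝ) * Complex.I) =
        (H η : ℂ) * ((Complex.exp (2 * Real.pi * η * p.1 * Complex.I) * φ p.1) *
          (starRingEnd ℂ) (Complex.exp (2 * Real.pi * η * p.2 * Complex.I) * φ p.2)) := by
      intro p
      rw [map_mul, ← Complex.exp_conj, show (2 * Real.pi * η * (p.1 - p.2 : ℝ) * Complex.I : ℂ) =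
        2 * Real.pi * η * p.1 * Complex.I +
          (starRingEnd ℂ) (2 * Real.pi * η * p.2 * Complex.I) by
        simp only [map_mul, Complex.conj_ofReal, Complex.conj_I, map_ofNat]
        push_cast
        ring, Complex.exp_add]
      ring
    simp_rw [h3]
    rw [integral_const_mul, Measure.volume_eq_prod, integral_prod_mul
      (fun x : ℝ => Complex.exp (2 * Real.pi * η * x * Complex.I) * φ x)
      (fun y : ℝ => (starRingEnd ℂ) (Complex.exp (2 * Real.pi * η * y * Complex.I) * φ y)),
      integral_conj, ← fourierInv_apply_real, Complex.mul_conj, Complex.normSq_eq_norm_sq]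
    push_cast
    rfl
  unfold kernelForm
  rw [← Complex.ofReal_re (∫ η, H η * ‖𝓕⁻ φ η‖ ^ 2), ← integral_complex_ofReal]
  congr 1
  rw [integral_integral (f := fun x y => (h (x - y) : ℂ) * φ x * (starRingEnd ℂ) (φ y)) hint2]
  simp_rw [h1]
  rw [integral_integral_swap hint]
  exact integral_congr_ae (Filter.Eventually.of_forall h2)

/-- Fourier inversion for `f ∈ L²` with integrable transform. -/
lemma fourierInv_fourier_ae_eq (f : Lp ℂ 2 (volume : Measure ℝ))
    (hF : Integrable (𝓕 f : Lp ℂ 2 (volume : Measure ℝ))) :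
    𝓕⁻ ((𝓕 f : Lp ℂ 2 (volume : Measure ℝ)) : ℝ → ℂ) =ᵐ[volume] f := by
  -- Both sides are tested against real smooth bumps `u`: inversion of tempered distributions gives
  -- the pairing with `f`, and self-adjointness gives the pairing with the inverse Fourier integral.
  refine ae_eq_of_integral_contDiff_smul_eq (continuous_fourierInv hF).locallyIntegrable
    ((Lp.memLp f).locallyIntegrable (by norm_num)) fun u hu hc => ?_
  have hc' : HasCompactSupport (Complex.ofRealCLM ∘ u) := hc.comp_left rfl
  have hu' : ContDiff ℝ (⊤ : ℕ∞) (Complex.ofRealCLM ∘ u) := by fun_prop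
  set Φ := hc'.toSchwartzMap hu' with hΦ
  have hΦx : ∀ x, Φ x = (u x : ℂ) := fun x => rfl
  have h1 := congrArg (fun T => T Φ) (Lp.fourierInv_toTemperedDistribution_eq (𝓕 f))
  simp only [TemperedDistribution.fourierInv_apply, Lp.toTemperedDistribution_apply,
    fourierInv_fourier_eq, smul_eq_mul] at h1
  have h2 := integral_fourierInv_mul hF Φ.integrable
  simp only [Complex.real_smul, ← hΦx]
  rw [← h1, SchwartzMap.fourierInv_coe]
  simp_rw [mul_comm (Φ _)]
  rw [h2]
  simp_rw [mul_comm]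

end FourierIntegrals

/-! ### Comparison of weights and the native bound -/

section NativeSpace

open FourierTransform

/-- The factor 2^(-5/4) π⁻¹ is what makes the constant times the lower bound for the density equal
to B e^(-t)/√(1+4t), with B the bracket under the root. What is left is the scalar inequality. -/
lemma exp_neg_le_const_mul_multiquadricDensity {σ c η : ℝ} (hσ : 0 < σ) (hc : 0 < c)
    (hη : η ≠ 0) :
    Real.exp (-((2 * Real.pi * η) ^ 2 / σ)) ≤
      (2 * Real.pi * ((2 : ℝ) ^ (-(5 / 4) : ℝ) * Real.pi⁻¹ *
        √(1 / Real.log 2 + 2 * √3 * MConst σ c)) ^ 2) * multiquadricDensity c η := by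
  have hη' : 0 < |η| := abs_pos.2 hη
  have hπ := Real.pi_pos
  set t := 2 * Real.pi * c * |η| with ht
  have ht0 : 0 < t := by positivity
  set B := 1 / Real.log 2 + 2 * √3 * MConst σ c with hB
  have hnum : √(1 + 4 * t) * Real.exp (t - t ^ 2 / (σ * c ^ 2)) ≤ B := sqrt_mul_exp_le hσ hc
  have hB0 : 0 ≤ B := le_trans (by positivity) hnum
  have hq : (2 * Real.pi * η) ^ 2 / σ = t ^ 2 / (σ * c ^ 2) := by
    rw [ht, mul_pow _ |η|, sq_abs]
    field_simp
  have h2 : ((2 : ℝ) ^ (-(5 / 4) : ℝ)) ^ 2 = (4 * √2)⁻¹ := by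
    rw [← Real.rpow_natCast, ← Real.rpow_mul (by norm_num), Real.sqrt_eq_rpow,
      show (4 : ℝ) = 2 ^ (2 : ℝ) by norm_num, ← Real.rpow_add (by norm_num),
      ← Real.rpow_neg (by norm_num)]
    norm_num
  have hs : √(Real.pi / (2 * t + 1 / 2)) = √2 * √Real.pi / √(1 + 4 * t) := by
    rw [← Real.sqrt_mul (by norm_num), ← Real.sqrt_div (by positivity)]
    congr 1
    field_simp
    ring
  have hK : (2 * Real.pi * ((2 : ℝ) ^ (-(5 / 4) : ℝ) * Real.pi⁻¹ * √B) ^ 2) *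
      (2 * √Real.pi * Real.exp (-t) * √(Real.pi / (2 * t + 1 / 2))) =
      B * Real.exp (-t) / √(1 + 4 * t) := by
    rw [mul_pow, mul_pow, h2, Real.sq_sqrt hB0, hs]
    have h2' : √2 ≠ 0 := by positivity
    have h3 : √(1 + 4 * t) ≠ 0 := by positivity
    field_simp
    rw [Real.sq_sqrt hπ.le]
    ring
  refine le_trans ?_ (mul_le_mul_of_nonneg_left (le_multiquadricDensity hc hη) (by positivity))
  rw [← ht, hK, le_div_iff₀ (by positivity), hq]
  calc Real.exp (-(t ^ 2 / (σ * c ^ 2))) * √(1 + 4 * t)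
      = √(1 + 4 * t) * Real.exp (t - t ^ 2 / (σ * c ^ 2)) * Real.exp (-t) := by
        rw [mul_assoc, ← Real.exp_add]; ring_nf
    _ ≤ B * Real.exp (-t) := by gcongr

/-- A weighted Cauchy-Schwarz inequality. -/
lemma integral_norm_mul_norm_le {F ψ : ℝ → ℂ} {w H : ℝ → ℝ} {K : ℝ} (hK : 0 ≤ K)
    (hF : AEStronglyMeasurable F) (hψ : AEStronglyMeasurable ψ)
    (hw : Measurable w) (hH : AEStronglyMeasurable H)
    (hw0 : ∀ η, 0 < w η) (hH0 : ∀ η, 0 ≤ H η)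
    (hFw : Integrable fun η => ‖F η‖ ^ 2 * w η) (hψH : Integrable fun η => H η * ‖ψ η‖ ^ 2)
    (hwH : ∀ᵐ η, (w η)⁻¹ ≤ K ^ 2 * H η) :
    ∫ η, ‖F η‖ * ‖ψ η‖ ≤ K * √(∫ η, ‖F η‖ ^ 2 * w η) * √(∫ η, H η * ‖ψ η‖ ^ 2) := by
  have hAsq : ∀ η, (‖F η‖ * √(w η)) ^ 2 = ‖F η‖ ^ 2 * w η := fun η => by
    rw [mul_pow, Real.sq_sqrt (hw0 η).le]
  have hBsq : ∀ η, (√(H η) * ‖ψ η‖) ^ 2 = H η * ‖ψ η‖ ^ 2 := fun η => by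
    rw [mul_pow, Real.sq_sqrt (hH0 η)]
  have hA : MemLp (fun η => ‖F η‖ * √(w η)) 2 := by
    refine (memLp_two_iff_integrable_sq (hF.norm.mul hw.sqrt.aestronglyMeasurable)).2 ?_
    simpa only [Pi.mul_apply, hAsq] using hFw
  have hB : MemLp (fun η => √(H η) * ‖ψ η‖) 2 := by
    refine (memLp_two_iff_integrable_sq
      ((Real.continuous_sqrt.comp_aestronglyMeasurable hH).mul hψ.norm)).2 ?_
    simpa only [Pi.mul_apply, hBsq] using hψH
  have hCS := integral_mul_le_Lp_mul_Lq_of_nonneg (μ := volume) Real.HolderConjugate.two_two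
    (f := fun η => ‖F η‖ * √(w η)) (g := fun η => √(H η) * ‖ψ η‖)
    (Filter.Eventually.of_forall fun η => by positivity)
    (Filter.Eventually.of_forall fun η => by positivity)
    (by simpa using hA) (by simpa using hB)
  simp only [Real.rpow_two, hAsq, hBsq, ← Real.sqrt_eq_rpow] at hCS
  have hAB : Integrable fun η => (‖F η‖ * √(w η)) * (√(H η) * ‖ψ η‖) := hA.integrable_mul hB
  calc ∫ η, ‖F η‖ * ‖ψ η‖ ≤ ∫ η, K * ((‖F η‖ * √(w η)) * (√(H η) * ‖ψ η‖)) := by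
        refine integral_mono_of_nonneg (Filter.Eventually.of_forall fun η => by positivity)
          (hAB.const_mul K) ?_
        filter_upwards [hwH] with η h
        -- Square root of the hypothesis 1 ≤ K² w H.
        have h1 : 1 ≤ K * √(w η) * √(H η) := by
          rw [mul_assoc, ← Real.sqrt_mul (hw0 η).le, ← Real.sqrt_sq hK,
            ← Real.sqrt_mul (sq_nonneg K), Real.one_le_sqrt]
          rw [inv_le_iff_one_le_mul₀ (hw0 η)] at h
          linarith
        calc ‖F η‖ * ‖ψ η‖ = 1 * (‖F η‖ * ‖ψ η‖) := (one_mul _).symm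
          _ ≤ (K * √(w η) * √(H η)) * (‖F η‖ * ‖ψ η‖) := by gcongr
          _ = _ := by ring
    _ = K * ∫ η, (‖F η‖ * √(w η)) * (√(H η) * ‖ψ η‖) := integral_const_mul _ _
    _ ≤ _ := by rw [mul_assoc]; gcongr

lemma integrable_fourier_weight {σ : ℝ} {f : Lp ℂ 2 (volume : Measure ℝ)}
    (hf : f ∈ gaussianSpace σ) :
    Integrable fun η : ℝ => ‖(𝓕 f : Lp ℂ 2 (volume : Measure ℝ)) η‖ ^ 2 *
      Real.exp ((2 * Real.pi * η) ^ 2 / σ) := by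
  have h := Integrable.comp_mul_left' hf Real.two_pi_pos.ne'
  simpa only [angularFourier, sq_abs, mul_div_cancel_left₀ _ Real.two_pi_pos.ne'] using h

lemma gaussianNorm_eq (σ : ℝ) (f : Lp ℂ 2 (volume : Measure ℝ)) :
    gaussianNorm σ f = √(2 * Real.pi) *
      √(∫ η : ℝ, ‖(𝓕 f : Lp ℂ 2 (volume : Measure ℝ)) η‖ ^ 2 *
        Real.exp ((2 * Real.pi * η) ^ 2 / σ)) := by
  have h := Measure.integral_comp_mul_left
    (fun ξ : ℝ => ‖angularFourier f ξ‖ ^ 2 * Real.exp (|ξ| ^ 2 / σ)) (2 * Real.pi)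
  simp only [angularFourier, sq_abs, mul_div_cancel_left₀ _ Real.two_pi_pos.ne'] at h
  have hπ := Real.two_pi_pos
  rw [h, abs_of_pos (by positivity), smul_eq_mul, ← Real.sqrt_mul (by positivity),
    mul_inv_cancel_left₀ hπ.ne']
  simp only [gaussianNorm, angularFourier, sq_abs]

/-- The transform is the product of two square-integrable functions: itself times the root of the
weight, and the reciprocal of that root, a Gaussian. -/
lemma integrable_fourier_of_mem_gaussianSpace {σ : ℝ} (hσ : 0 < σ)
    {f : Lp ℂ 2 (volume : Measure ℝ)} (hf : f ∈ gaussianSpace σ) :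
    Integrable (𝓕 f : Lp ℂ 2 (volume : Measure ℝ)) := by
  set F := (𝓕 f : Lp ℂ 2 (volume : Measure ℝ))
  have hF := Lp.aestronglyMeasurable F
  have hA : MemLp (fun η => ‖F η‖ * Real.exp ((2 * Real.pi * η) ^ 2 / σ / 2)) 2 := by
    have hw : Continuous fun η : ℝ => Real.exp ((2 * Real.pi * η) ^ 2 / σ / 2) := by fun_prop
    refine (memLp_two_iff_integrable_sq (hF.norm.mul hw.aestronglyMeasurable)).2 ?_
    refine (integrable_fourier_weight hf).congr (Filter.Eventually.of_forall fun η => ?_)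
    simp only [Pi.mul_apply, mul_pow _ (Real.exp _), ← Real.exp_nat_mul, F]
    push_cast
    ring_nf
  have hB : MemLp (fun η : ℝ => Real.exp (-((2 * Real.pi * η) ^ 2 / σ / 2))) 2 := by
    rw [memLp_two_iff_integrable_sq (Continuous.aestronglyMeasurable (by fun_prop))]
    refine (integrable_exp_neg_mul_sq (b := (2 * Real.pi) ^ 2 / σ) (by positivity)).congr
      (Filter.Eventually.of_forall fun η => ?_)
    simp only [← Real.exp_nat_mul]
    push_cast
    ring_nf
  refine (integrable_norm_iff hF).1 ((hA.integrable_mul hB).congr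
    (Filter.Eventually.of_forall fun η => ?_))
  simp only [Pi.mul_apply, mul_assoc, ← Real.exp_add]
  simp

lemma isNativeBound_fourierInv {σ c : ℝ} (hσ : 0 < σ) (hc : 0 < c) (m : ℕ)
    {f : Lp ℂ 2 (volume : Measure ℝ)} (hf : f ∈ gaussianSpace σ) :
    IsNativeBound (multiquadric (-1) c) m
      (𝓕⁻ ((𝓕 f : Lp ℂ 2 (volume : Measure ℝ)) : ℝ → ℂ))
      ((2 : ℝ) ^ (-(5 / 4) : ℝ) * Real.pi⁻¹ *
        √(1 / Real.log 2 + 2 * √3 * MConst σ c) * gaussianNorm σ f) := by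
  have hπ := Real.pi_pos
  have hG : 0 ≤ gaussianNorm σ f := Real.sqrt_nonneg _
  refine ⟨by positivity, fun φ hφ => ?_⟩
  have hφi : Integrable φ := hφ.1.continuous.integrable_of_hasCompactSupport hφ.2.1
  have hF := integrable_fourier_of_mem_gaussianSpace hσ hf
  have hH := integrable_multiquadricDensity hc
  have hψ := (continuous_fourierInv hφi).aestronglyMeasurable (μ := volume)
  rw [integral_fourierInv_mul hF hφi,
    kernelForm_eq_integral hH (integral_multiquadricDensity_mul_cexp hc) hφi]
  refine (norm_integral_le_integral_norm _).trans ?_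
  simp_rw [norm_mul]
  set A := (2 : ℝ) ^ (-(5 / 4) : ℝ) * Real.pi⁻¹ *
    √(1 / Real.log 2 + 2 * √3 * MConst σ c) with hA
  have hA0 : 0 ≤ A := by positivity
  have hψH : Integrable fun η => multiquadricDensity c η * ‖𝓕⁻ φ η‖ ^ 2 := by
    refine hH.mul_bdd (c := (∫ x, ‖φ x‖) ^ 2) (hψ.norm.pow 2)
      (Filter.Eventually.of_forall fun η => ?_)
    rw [norm_pow, norm_norm]
    exact pow_le_pow_left₀ (norm_nonneg _) (norm_fourierInv_le φ η) 2
  -- The factor √(2π) comes from ξ = 2πη: it is the ratio of `gaussianNorm` to the weighted norm in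
  -- η.
  refine (integral_norm_mul_norm_le (K := √(2 * Real.pi) * A)
    (w := fun η => Real.exp ((2 * Real.pi * η) ^ 2 / σ)) (by positivity)
    hF.aestronglyMeasurable hψ (by fun_prop) hH.aestronglyMeasurable
    (fun η => Real.exp_pos _) (multiquadricDensity_nonneg c) (integrable_fourier_weight hf)
    hψH ?_).trans_eq ?_
  -- At η = 0 the integral defining the density diverges and takes the default value 0, so the
  -- comparison fails at that one point.
  · filter_upwards [compl_mem_ae_iff.2 (measure_singleton (0 : ℝ))] with η hη
    have := exp_neg_le_const_mul_multiquadricDensity hσ hc (η := η) hη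
    rwa [← Real.exp_neg, mul_pow √(2 * Real.pi), Real.sq_sqrt (by positivity)]
  · rw [gaussianNorm_eq]
    ring

end NativeSpace

theorem theorem2p5 (σ c : ℝ) (hσ : 0 < σ) (hc : 0 < c)
    (f : Lp ℂ 2 (volume : Measure ℝ)) (hf : f ∈ gaussianSpace σ) :
    ∃ g : ℝ → ℂ, g =ᵐ[volume] f ∧
      g ∈ nativeSpace (multiquadric (-1) c) (cpdOrder (-1)) ∧
      nativeNorm (multiquadric (-1) c) (cpdOrder (-1)) g ≤
        (2 : ℝ) ^ (-(5 / 4) : ℝ) * Real.pi⁻¹ *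
          Real.sqrt (1 / Real.log 2 + 2 * Real.sqrt 3 * MConst σ c) * gaussianNorm σ f := by
  have hB := isNativeBound_fourierInv hσ hc (cpdOrder (-1)) hf
  exact ⟨_, fourierInv_fourier_ae_eq f (integrable_fourier_of_mem_gaussianSpace hσ hf),
    ⟨continuous_fourierInv (integrable_fourier_of_mem_gaussianSpace hσ hf), _, hB⟩,
    csInf_le ⟨0, fun _ h => h.1⟩ hB⟩
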